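/- Let $(V,\mathcal B)$ be a standard Borel space, let $\Delta\in\mathbb N$, and let $\mathcal G=(V,\mathcal B,E)$ be a Borel graph (a simple graph on $V$ whose edge relation is Borel in $V\times V$) in which every vertex has at most $\Delta$ neighbours. Let $\mu$ be a Borel probability measure on $V$ that is $\mathcal G$-quasi-invariant: whenever $A\in\mathcal B$ and $\mu(A)=0$, the union $[A]_{\mathcal G}$ of all connected components of $\mathcal G$ meeting $A$ satisfies $\mu([A]_{\mathcal G})=0$. For a $\mathcal G$-quasi-invariant Borel probability measure $\nu$, a (version of the) Radon–Nikodym cocycle of $\nu$ is a Borel function $\rho_\nu:F_{\mathcal G}\to(0,\infty)$ on the set $F_{\mathcal G}\subseteq V\times V$ of pairs of points in the same connected component, such that $$\nu(g(C))=\int_C\rho_\nu(x,g(x))\,d\nu(x)$$ for every Borel set $C\subseteq V$ and every injective Borel map $g:C\to V$ with $(x,g(x))\in F_{\mathcal G}$ for all $x\in C$. Then there is a Borel probability measure $\nu$ on $V$ with the same null sets as $\mu$ such that $$\frac1{4\Delta}\le\rho_\nu(x,y)\le4\Delta\qquad\text{for every edge }(x,y)\in E,$$ and such that, in particular, $\rho_\nu(x,y)\le(4\Delta)^k$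 whenever $x,y$ are at finite graph distance $\operatorname{dist}_{\mathcal G}(x,y)=k\in\mathbb N$. Precisely (the cocycle being determined only up to null sets): there is a version $\rho_\nu$ of the Radon–Nikodym cocycle of $\nu$ for which these bounds hold for all such $x,y\in V$; and for every version $\rho_\nu$ there is a $\mathcal G$-invariant Borel set $A\subseteq V$ (a union of connected components) with $\nu(V\setminus A)=0$ such that these bounds hold for all such $x,y\in A$. -/

import Mathlib

open MeasureTheory

/-- A graph on a measurable space is Borel if its edge set is, that is, if the (symmetric) set of
ordered pairs of adjacent points is measurable in the product. -/
def IsBorelGraph {V : Type*} [MeasurableSpace V] (G : SimpleGraph V) : Prop :=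
  MeasurableSet {p : V × V | G.Adj p.1 p.2}

/-- Every vertex has at most `Δ` neighbours. -/
def DegreeBoundedBy {V : Type*} (G : SimpleGraph V) (Δ : ℕ) : Prop :=
  ∀ x : V, (G.neighborSet x).encard ≤ (Δ : ℕ∞)

/-- The connectedness relation of `G`, as a set of ordered pairs. -/
def connRel {V : Type*} (G : SimpleGraph V) : Set (V × V) :=
  {p | G.Reachable p.1 p.2}

/-- The saturation of `A`: the union of all connected components of `G` that meet `A`. -/
def graphSaturation {V : Type*} (G : SimpleGraph V) (A : Set V) : Set V :=
  {y | ∃ x ∈ A, G.Reachable x y}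

/-- `A` is a union of connected components of `G`. -/
def IsGraphInvariant {V : Type*} (G : SimpleGraph V) (A : Set V) : Prop :=
  graphSaturation G A = A

/-- Saturations of Borel null sets are null. -/
def IsQuasiInvariant {V : Type*} [MeasurableSpace V] (G : SimpleGraph V) (μ : Measure V) : Prop :=
  ∀ A : Set V, MeasurableSet A → μ A = 0 → μ (graphSaturation G A) = 0

/-- `ρ` is a (version of the) Radon–Nikodym cocycle of `μ` with respect to the connectedness
relation of `G`: a positive Borel function on that relation which computes the measure of the image
`g(C)` for every injective Borel map `g : C → V` that moves points inside their components.
Only the values of `ρ` on the connectedness relation matter. -/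
structure IsRadonNikodymCocycle {V : Type*} [MeasurableSpace V] (G : SimpleGraph V)
    (μ : Measure V) (ρ : V → V → ℝ) : Prop where
  measurable : Measurable (fun p : connRel G => ρ p.1.1 p.1.2)
  pos : ∀ x y : V, G.Reachable x y → 0 < ρ x y
  measure_image : ∀ (C : Set V) (g : V → V), MeasurableSet C → Measurable (C.domRestrict g) →
    Set.InjOn g C → (∀ x ∈ C, G.Reachable x (g x)) →
      μ (g '' C) = ∫⁻ x in C, ENNReal.ofReal (ρ x (g x)) ∂μ

/-! Uniformization writes the edge relation as the union of the graphs of Δ Borel partial functions.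
Let `P` send a measure to the sum of its pushforwards under them. With c = 2Δ + 1, the series ∑ c⁻ᵏ
Pᵏμ converges, because `P` multiplies total mass by at most Δ < c. It dominates μ, and it is
absolutely continuous with respect to μ by quasi-invariance. Shifting the index shows that `P`
expands it by at most c, so after normalization to ν the neighbourhood of a Borel set B has measure
at most c ν(B) (`exists_equivalent_measure_preimage_le`). Iterating, the points at distance k from A
have measure at most cᵏ ν(A).

The connectedness relation splits into countably many graphs of Borel partial injections, each
moving points by a fixed distance k (`exists_partition_connRel`). Distance is symmetric, so such an
injection distorts ν by at most cᵏ in both directions, and its density can be taken in [c⁻ᵏ, cᵏ].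
Gluing the densities gives a bounded cocycle. Any other version violates the bounds on countably
many null sets, whose saturation is removed. Finally c ≤ 4Δ as soon as there is an edge. -/

open scoped ENNReal

universe u

/-! ### Borel uniformization with bounded sections -/

/-- A uniformization theorem with bounded sections: a Borel set all of whose sections have at most
`n` points is a union of the graphs of `n` Borel partial functions. -/
theorem exists_partial_functions_of_encard_le {Y : Type u} [MeasurableSpace Y]
    [StandardBorelSpace Y] [Nonempty Y] (n : ℕ) :
    ∀ (X : Type u) [MeasurableSpace X] [StandardBorelSpace X] (E : Set (X × Y)),
      MeasurableSet E → (∀ x, {y | (x, y) ∈ E}.encard ≤ n) →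
      ∃ (D : Fin n → Set X) (f : Fin n → X → Y), (∀ i, MeasurableSet (D i)) ∧
        (∀ i, Measurable (f i)) ∧ ∀ x y, (x, y) ∈ E ↔ ∃ i, x ∈ D i ∧ f i x = y := by
  obtain ⟨e, he⟩ := exists_measurableEmbedding_real Y
  induction n with
  | zero =>
    intro X _ _ E _ hn
    refine ⟨Fin.elim0, Fin.elim0, fun i => i.elim0, fun i => i.elim0, fun x y => ?_⟩
    have h : {y | (x, y) ∈ E} = ∅ := by simpa using hn x
    have hy : y ∉ {y | (x, y) ∈ E} := by simp [h]
    exact ⟨fun h => absurd h hy, fun ⟨i, _⟩ => i.elim0⟩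
  | succ n ih =>
    intro X _ _ E hE hn
    -- Over a point (x, y) of `E`, the section of `F` consists of the points of the fibre strictly
    -- below y in the order pulled back from ℝ, so there are at most n. The induction hypothesis
    -- over `X × Y` then makes the set of non-minimal points Borel, although a projection is a
    -- priori only analytic.
    let F : Set ((X × Y) × Y) := {q | q.1 ∈ E ∧ (q.1.1, q.2) ∈ E ∧ e q.2 < e q.1.2}
    have hF : MeasurableSet F := by
      refine (measurable_fst hE).inter (MeasurableSet.inter ?_ ?_)
      · exact (measurable_fst.fst.prodMk measurable_snd) hE
      · exact measurableSet_lt (he.measurable.comp measurable_snd)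
          (he.measurable.comp measurable_fst.snd)
    have hle : ∀ (x : X) (y : Y), (x, y) ∈ E → ({z | (x, z) ∈ E} \ {y}).encard ≤ n := by
      intro x y hy
      have h1 := Set.encard_sdiff_singleton_add_one (s := {z | (x, z) ∈ E}) hy
      have h2 := hn x
      rw [← h1, Nat.cast_succ] at h2
      exact (ENat.add_le_add_iff_right ENat.one_ne_top).1 h2
    obtain ⟨D', f', hD', -, hDf'⟩ := ih (X × Y) F hF (by
      rintro ⟨x, y⟩
      by_cases hy : (x, y) ∈ E
      · refine le_trans (Set.encard_le_encard ?_) (hle x y hy)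
        rintro z ⟨-, hz, hlt⟩
        refine ⟨hz, ?_⟩
        rintro rfl
        exact lt_irrefl _ hlt
      · have : {z | ((x, y), z) ∈ F} = ∅ := by
          ext z
          simp [F, hy]
        simp [this])
    have hφ : MeasurableSet (⋃ i, D' i) := MeasurableSet.iUnion hD'
    have hmem : ∀ p : X × Y, p ∈ ⋃ i, D' i ↔ ∃ z, (p, z) ∈ F := by
      intro p
      simp only [hDf', Set.mem_iUnion]
      exact ⟨fun ⟨i, hi⟩ => ⟨_, i, hi, rfl⟩, fun ⟨_, i, hi, _⟩ => ⟨i, hi⟩⟩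
    have hmin : ∀ x y, (x, y) ∈ E → ∃ m, (x, m) ∈ E \ ⋃ i, D' i := by
      intro x y hy
      have hfin : {z | (x, z) ∈ E}.Finite :=
        Set.finite_of_encard_le_coe (hn x)
      obtain ⟨m, hm, hmin⟩ := Set.exists_min_image _ e hfin ⟨y, hy⟩
      refine ⟨m, hm, fun h => ?_⟩
      obtain ⟨z, -, hz, hlt⟩ := (hmem _).1 h
      exact absurd (hmin z hz) (not_le.2 hlt)
    have hinj : Set.InjOn (Prod.fst : X × Y → X) (E \ ⋃ i, D' i) := by
      rintro ⟨x, y⟩ hy ⟨x', z⟩ hz (rfl : x = x')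
      have hyz : ¬ e z < e y := fun h => hy.2 ((hmem _).2 ⟨z, hy.1, hz.1, h⟩)
      have hzy : ¬ e y < e z := fun h => hz.2 ((hmem _).2 ⟨y, hz.1, hy.1, h⟩)
      rw [he.injective (le_antisymm (not_lt.1 hzy) (not_lt.1 hyz))]
    have hM : MeasurableSet (E \ ⋃ i, D' i) := hE.diff hφ
    have := hM.standardBorel
    -- Each fibre has at most one minimal point, so Lusin–Souslin makes the minimal points the graph
    -- of a Borel partial function.
    have hemb : MeasurableEmbedding (fun p : ↥(E \ ⋃ i, D' i) => p.1.1) :=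
      (measurable_fst.comp measurable_subtype_coe).measurableEmbedding
        (fun p q h => Subtype.ext (hinj p.2 q.2 h))
    obtain ⟨f₀, hf₀, hf₀'⟩ := hemb.exists_measurable_extend
      (g := fun p : ↥(E \ ⋃ i, D' i) => p.1.2) (measurable_snd.comp measurable_subtype_coe)
      (fun _ => inferInstance)
    have hf₀m : ∀ x y, (x, y) ∈ E \ ⋃ i, D' i → f₀ x = y := fun x y h => congrFun hf₀' ⟨(x, y), h⟩
    -- Discarding the minimum leaves at most n points in each fibre.
    obtain ⟨D, f, hD, hf, hDf⟩ := ih X (E ∩ ⋃ i, D' i) (hE.inter hφ) (by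
      intro x
      rcases Set.eq_empty_or_nonempty {y | (x, y) ∈ E ∩ ⋃ i, D' i} with h | ⟨y, hy⟩
      · rw [h]
        simp
      · obtain ⟨m, hm⟩ := hmin x y hy.1
        refine le_trans (Set.encard_le_encard ?_) (hle x m hm.1)
        rintro z hz
        refine ⟨hz.1, ?_⟩
        rintro rfl
        exact hm.2 hz.2)
    refine ⟨Fin.cons (Prod.fst '' (E \ ⋃ i, D' i)) D, Fin.cons f₀ f, ?_, ?_, ?_⟩
    · refine Fin.cases ?_ hD
      exact hM.image_of_measurable_injOn measurable_fst hinj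
    · exact Fin.cases hf₀ hf
    · intro x y
      rw [Fin.exists_fin_succ]
      simp only [Fin.cons_zero, Fin.cons_succ, ← hDf]
      constructor
      · intro h
        by_cases h' : (x, y) ∈ ⋃ i, D' i
        · exact Or.inr ⟨h, h'⟩
        · exact Or.inl ⟨⟨(x, y), ⟨h, h'⟩, rfl⟩, hf₀m x y ⟨h, h'⟩⟩
      · rintro (⟨⟨⟨x', z⟩, hz, rfl⟩, rfl⟩ | h)
        · rw [hf₀m x' z hz]
          exact hz.1
        · exact h.1

/-! ### Walks as words in the partial functions, and the Borel structure of connectedness -/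

section Words

variable {V : Type u} {ι : Type*}

/-- The composition of the partial functions `f i` along a word. -/
def wordMap (f : ι → V → V) : List ι → V → V
  | [], x => x
  | i :: w, x => wordMap f w (f i x)

/-- The domain of the composition of the partial functions `f i`, defined on `D i`, along a
word. -/
def wordDomain (D : ι → Set V) (f : ι → V → V) : List ι → Set V
  | [] => Set.univ
  | i :: w => D i ∩ f i ⁻¹' wordDomain D f w

theorem measurable_wordMap [MeasurableSpace V] {f : ι → V → V} (hf : ∀ i, Measurable (f i)) :
    ∀ w, Measurable (wordMap f w)
  | [] => measurable_id
  | i :: w => (measurable_wordMap hf w).comp (hf i)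

theorem measurableSet_wordDomain [MeasurableSpace V] {D : ι → Set V} {f : ι → V → V}
    (hD : ∀ i, MeasurableSet (D i)) (hf : ∀ i, Measurable (f i)) :
    ∀ w, MeasurableSet (wordDomain D f w)
  | [] => MeasurableSet.univ
  | i :: w => (hD i).inter (hf i (measurableSet_wordDomain hD hf w))

theorem exists_walk_iff_exists_word {G : SimpleGraph V} {D : ι → Set V} {f : ι → V → V}
    (h : ∀ x y, G.Adj x y ↔ ∃ i, x ∈ D i ∧ f i x = y) (k : ℕ) (x y : V) :
    (∃ p : G.Walk x y, p.length = k) ↔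
      ∃ w, w.length = k ∧ x ∈ wordDomain D f w ∧ wordMap f w x = y := by
  induction k generalizing x with
  | zero =>
    constructor
    · rintro ⟨p, hp⟩
      exact ⟨[], rfl, trivial, SimpleGraph.Walk.eq_of_length_eq_zero hp⟩
    · rintro ⟨w, hw, -, rfl⟩
      rw [List.length_eq_zero_iff] at hw
      subst hw
      exact ⟨SimpleGraph.Walk.nil, rfl⟩
  | succ k ih =>
    constructor
    · rintro ⟨p, hp⟩
      cases p with
      | nil => simp at hp
      | cons hadj q =>
        obtain ⟨w, hw, hxw, hwy⟩ := (ih _).1 ⟨q, by simpa using hp⟩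
        obtain ⟨i, hi, rfl⟩ := (h _ _).1 hadj
        exact ⟨i :: w, by simp [hw], ⟨hi, hxw⟩, hwy⟩
    · rintro ⟨w, hw, hxw, hwy⟩
      cases w with
      | nil => simp at hw
      | cons i w =>
        obtain ⟨q, hq⟩ := (ih (f i x)).2 ⟨w, by simpa using hw, hxw.2, hwy⟩
        exact ⟨SimpleGraph.Walk.cons ((h _ _).2 ⟨i, hxw.1, rfl⟩) q, by simp [hq]⟩

end Words

theorem edist_eq_natCast_iff {V : Type*} {G : SimpleGraph V} {x y : V} {k : ℕ} :
    G.edist x y = k ↔ (∃ p : G.Walk x y, p.length = k) ∧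
      ∀ j < k, ¬ ∃ p : G.Walk x y, p.length = j := by
  constructor
  · intro h
    constructor
    · obtain ⟨p, hp⟩ := SimpleGraph.exists_walk_of_edist_ne_top (G := G) (u := x) (v := y)
        (by simp [h])
      exact ⟨p, by rw [h] at hp; exact_mod_cast hp⟩
    · rintro j hj ⟨p, rfl⟩
      have := SimpleGraph.edist_le p
      rw [h] at this
      exact absurd hj (not_lt.2 (by exact_mod_cast this))
  · rintro ⟨⟨p, rfl⟩, hmin⟩
    obtain ⟨q, hq⟩ := p.reachable.exists_walk_length_eq_edist
    refine le_antisymm (SimpleGraph.edist_le p) ?_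
    rw [← hq]
    by_contra hlt
    exact hmin q.length (by exact_mod_cast not_le.1 hlt) ⟨q, rfl⟩

/-- The connectedness relation is a countable disjoint union of Borel sets, each the graph of a
Borel partial injection with Borel inverse that moves points by a fixed distance. -/
theorem exists_partition_connRel {V : Type u} [MeasurableSpace V] [StandardBorelSpace V]
    {ι : Type*} [Countable ι] {G : SimpleGraph V} {D : ι → Set V} {f : ι → V → V}
    (hD : ∀ i, MeasurableSet (D i)) (hf : ∀ i, Measurable (f i))
    (h : ∀ x y, G.Adj x y ↔ ∃ i, x ∈ D i ∧ f i x = y) :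
    ∃ (S : ℕ → Set (V × V)) (φ ψ : ℕ → V → V) (k : ℕ → ℕ),
      (∀ n, MeasurableSet (S n)) ∧ (∀ n, Measurable (φ n)) ∧ (∀ n, Measurable (ψ n)) ∧
      Pairwise (Function.onFun Disjoint S) ∧ (⋃ n, S n) = connRel G ∧
      ∀ n x y, (x, y) ∈ S n → φ n x = y ∧ ψ n y = x ∧ G.edist x y = k n := by
  have hgraph : ∀ w, MeasurableSet
      {p : V × V | p.1 ∈ wordDomain D f w ∧ wordMap f w p.1 = p.2} := fun w =>
    (measurable_fst (measurableSet_wordDomain hD hf w)).inter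
      (measurableSet_eq_fun ((measurable_wordMap hf w).comp measurable_fst) measurable_snd)
  have hwalk : ∀ k, MeasurableSet {p : V × V | ∃ q : G.Walk p.1 p.2, q.length = k} := by
    intro k
    have : {p : V × V | ∃ q : G.Walk p.1 p.2, q.length = k} =
        ⋃ w : {w : List ι // w.length = k},
          {p : V × V | p.1 ∈ wordDomain D f w ∧ wordMap f w p.1 = p.2} := by
      ext p
      simp [exists_walk_iff_exists_word h, and_left_comm]
    rw [this]
    exact MeasurableSet.iUnion fun w => hgraph w
  have hdist : ∀ k : ℕ, MeasurableSet {p : V × V | G.edist p.1 p.2 = k} := by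
    intro k
    simp only [edist_eq_natCast_iff]
    refine (hwalk k).inter ?_
    have : {p : V × V | ∀ j < k, ¬ ∃ q : G.Walk p.1 p.2, q.length = j} =
        ⋂ j, ⋂ (_ : j < k), {p : V × V | ∃ q : G.Walk p.1 p.2, q.length = j}ᶜ := by
      ext p
      simp
    change MeasurableSet {p : V × V | ∀ j < k, ¬ ∃ q : G.Walk p.1 p.2, q.length = j}
    rw [this]
    exact MeasurableSet.iInter fun j => MeasurableSet.iInter fun _ => (hwalk j).compl
  obtain ⟨e, he⟩ := exists_surjective_nat (List ι × List ι)
  -- The first word leads from x to y along a geodesic and the second leads back, so each piece is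
  -- the graph of an injection whose inverse is also a word map.
  let T : List ι × List ι → Set (V × V) := fun w =>
    ({p | p.1 ∈ wordDomain D f w.1 ∧ wordMap f w.1 p.1 = p.2} ∩
      Prod.swap ⁻¹' {p | p.1 ∈ wordDomain D f w.2 ∧ wordMap f w.2 p.1 = p.2}) ∩
      {p | G.edist p.1 p.2 = w.1.length}
  have hT : ∀ w, MeasurableSet (T w) := fun w =>
    ((hgraph w.1).inter (measurable_swap (hgraph w.2))).inter (hdist _)
  refine ⟨disjointed (T ∘ e), fun n => wordMap f (e n).1, fun n => wordMap f (e n).2,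
    fun n => (e n).1.length, fun n => MeasurableSet.disjointed (fun n => hT (e n)) n,
    fun n => measurable_wordMap hf _, fun n => measurable_wordMap hf _,
    disjoint_disjointed _, ?_, ?_⟩
  · rw [iUnion_disjointed]
    change ⋃ n, T (e n) = _
    rw [he.iUnion_comp T]
    ext ⟨x, y⟩
    rw [Set.mem_iUnion]
    constructor
    · rintro ⟨w, hw⟩
      have : G.edist x y = w.1.length := hw.2
      exact SimpleGraph.edist_ne_top_iff_reachable.1 (by simp [this])
    · intro hxy
      obtain ⟨p, hp⟩ := SimpleGraph.Reachable.exists_walk_length_eq_edist (G := G) hxy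
      obtain ⟨w, hw, hw1⟩ := (exists_walk_iff_exists_word h _ _ _).1 ⟨p, rfl⟩
      obtain ⟨w', -, hw1'⟩ := (exists_walk_iff_exists_word h _ _ _).1 ⟨p.reverse, rfl⟩
      exact ⟨(w, w'), ⟨hw1, hw1'⟩, by simp [hw, ← hp]⟩
  · intro n x y hxy
    have hxy' := disjointed_subset (T ∘ e) n hxy
    exact ⟨hxy'.1.1.2, hxy'.1.2.2, hxy'.2⟩

/-! ### The equivalent measure and its expansion rate -/

/-- A finite family of partial functions preserving null sets admits an equivalent probability
measure that is expanded by at most a constant factor under taking preimages. -/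
theorem exists_equivalent_measure_preimage_le {V : Type*} [MeasurableSpace V] {m : ℕ}
    {D : Fin m → Set V} {f : Fin m → V → V} (hD : ∀ i, MeasurableSet (D i))
    (hf : ∀ i, Measurable (f i)) (μ : Measure V) [IsProbabilityMeasure μ]
    (hμ : ∀ i B, MeasurableSet B → μ B = 0 → μ (D i ∩ f i ⁻¹' B) = 0) :
    ∃ ν : Measure V, IsProbabilityMeasure ν ∧ μ ≪ ν ∧ ν ≪ μ ∧
      ∀ B, MeasurableSet B → ν (⋃ i, D i ∩ f i ⁻¹' B) ≤ (2 * m + 1 : ℝ≥0∞) * ν B := by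
  -- Any constant above m makes the series converge; the summand 1 keeps c nonzero when m = 0.
  let c : ℝ≥0∞ := 2 * m + 1
  have hc0 : c ≠ 0 := by simp [c]
  have hct : c ≠ ∞ := by simp [c, ENNReal.mul_eq_top]
  let P : Measure V → Measure V := fun κ => ∑ i, (κ.restrict (D i)).map (f i)
  have hP : ∀ κ B, MeasurableSet B → P κ B = ∑ i, κ (D i ∩ f i ⁻¹' B) := by
    intro κ B hB
    simp only [P, Measure.finsetSum_apply]
    refine Finset.sum_congr rfl fun i _ => ?_
    rw [Measure.map_apply (hf i) hB, Measure.restrict_apply (hf i hB), Set.inter_comm]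
  let κ : ℕ → Measure V := fun k => P^[k] μ
  have hκ : ∀ k, κ (k + 1) = P (κ k) := fun k => Function.iterate_succ_apply' P k μ
  have hκac : ∀ k B, MeasurableSet B → μ B = 0 → κ k B = 0 := by
    intro k
    induction k with
    | zero => exact fun B _ h => h
    | succ k ih =>
      intro B hB h
      rw [hκ, hP _ _ hB]
      exact Finset.sum_eq_zero fun i _ => ih _ ((hD i).inter (hf i hB)) (hμ i B hB h)
  have hκuniv : ∀ k, κ k Set.univ ≤ (m : ℝ≥0∞) ^ k := by
    intro k
    induction k with
    | zero => simp [κ]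
    | succ k ih =>
      rw [hκ, hP _ _ MeasurableSet.univ]
      calc ∑ i, κ k (D i ∩ f i ⁻¹' Set.univ) ≤ ∑ _i : Fin m, (m : ℝ≥0∞) ^ k :=
            Finset.sum_le_sum fun i _ => (measure_mono (Set.subset_univ _)).trans ih
        _ = (m : ℝ≥0∞) ^ (k + 1) := by simp [pow_succ']
  let ν₀ : Measure V := Measure.sum fun k => (c⁻¹) ^ k • κ k
  have hν₀ : ∀ B, MeasurableSet B → ν₀ B = ∑' k, (c⁻¹) ^ k * κ k B := by
    intro B hB
    simp [ν₀, Measure.sum_apply _ hB]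
  have hfin : ν₀ Set.univ ≠ ∞ := by
    rw [hν₀ _ MeasurableSet.univ]
    have hlt : c⁻¹ * m < 1 := by
      rw [mul_comm, ← div_eq_mul_inv]
      refine (ENNReal.div_lt_iff (Or.inl hc0) (Or.inl hct)).2 ?_
      rw [one_mul]
      have : m < 2 * m + 1 := by omega
      simp only [c]
      exact_mod_cast this
    refine ne_top_of_le_ne_top ?_ (ENNReal.tsum_le_tsum fun k =>
      (mul_le_mul_right (hκuniv k) _ : (c⁻¹) ^ k * κ k Set.univ ≤ (c⁻¹) ^ k * (m : ℝ≥0∞) ^ k))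
    simp only [← mul_pow]
    rw [ENNReal.tsum_geometric]
    exact ENNReal.inv_ne_top.2 (tsub_pos_of_lt hlt).ne'
  have : IsFiniteMeasure ν₀ := ⟨lt_top_iff_ne_top.2 hfin⟩
  have hle : μ ≤ ν₀ := by
    refine Measure.le_iff.2 fun B hB => ?_
    rw [hν₀ B hB]
    simpa [κ] using ENNReal.le_tsum (f := fun k => (c⁻¹) ^ k * κ k B) 0
  have hne : ν₀ ≠ 0 := by
    intro h
    have := hle Set.univ
    simp [h] at this
  have : NeZero ν₀ := ⟨hne⟩
  -- Applying `P` turns the k-th term of the series into c times the (k + 1)-st.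
  have hkey : ∀ B, MeasurableSet B → ν₀ (⋃ i, D i ∩ f i ⁻¹' B) ≤ c * ν₀ B := by
    intro B hB
    calc ν₀ (⋃ i, D i ∩ f i ⁻¹' B) ≤ ∑ i, ν₀ (D i ∩ f i ⁻¹' B) := by
          simpa using measure_iUnion_le (μ := ν₀) fun i => D i ∩ f i ⁻¹' B
      _ = ∑ i, ∑' k, (c⁻¹) ^ k * κ k (D i ∩ f i ⁻¹' B) :=
          Finset.sum_congr rfl fun i _ => hν₀ _ ((hD i).inter (hf i hB))
      _ = ∑' k, (c⁻¹) ^ k * κ (k + 1) B := by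
          rw [← Summable.tsum_finsetSum fun i _ => ENNReal.summable]
          refine tsum_congr fun k => ?_
          rw [hκ, hP _ _ hB, Finset.mul_sum]
      _ = c * ∑' k, (c⁻¹) ^ (k + 1) * κ (k + 1) B := by
          rw [← ENNReal.tsum_mul_left]
          refine tsum_congr fun k => ?_
          rw [pow_succ', mul_assoc, ← mul_assoc, ENNReal.mul_inv_cancel hc0 hct, one_mul]
      _ ≤ c * ν₀ B := by
          rw [hν₀ B hB]
          refine mul_le_mul_right ?_ c
          exact ENNReal.tsum_comp_le_tsum_of_injective (add_left_injective 1)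
            fun k => (c⁻¹) ^ k * κ k B
  refine ⟨(ν₀ Set.univ)⁻¹ • ν₀, inferInstance, ?_, ?_, ?_⟩
  · exact (Measure.absolutelyContinuous_of_le hle).trans
      (Measure.absolutelyContinuous_smul (ENNReal.inv_ne_zero.2 hfin))
  · refine Measure.AbsolutelyContinuous.mk fun B hB h => ?_
    simp [hν₀ B hB, hκac _ B hB h]
  · intro B hB
    simp only [Measure.smul_apply, smul_eq_mul]
    rw [mul_left_comm]
    gcongr
    exact hkey B hB

theorem measure_edist_neighborhood_le {V : Type*} [MeasurableSpace V] {G : SimpleGraph V}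
    {ν : Measure V} {c : ℝ≥0∞}
    (h : ∀ B, MeasurableSet B → ν {x | ∃ y ∈ B, G.Adj x y} ≤ c * ν B) (k : ℕ) (A : Set V) :
    ν {x | ∃ y ∈ A, G.edist x y = k} ≤ c ^ k * ν A := by
  have hwalk : ∀ k : ℕ, ν {x | ∃ y ∈ A, ∃ p : G.Walk x y, p.length = k} ≤ c ^ k * ν A := by
    intro k
    induction k with
    | zero =>
      rw [pow_zero, one_mul]
      refine measure_mono ?_
      rintro x ⟨y, hy, p, hp⟩
      exact SimpleGraph.Walk.eq_of_length_eq_zero hp ▸ hy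
    | succ k ih =>
      -- The one-step bound is available only for measurable sets; a measurable hull has the same
      -- measure.
      let B := toMeasurable ν {x | ∃ y ∈ A, ∃ p : G.Walk x y, p.length = k}
      calc ν {x | ∃ y ∈ A, ∃ p : G.Walk x y, p.length = k + 1}
          ≤ ν {x | ∃ y ∈ B, G.Adj x y} := by
            refine measure_mono ?_
            rintro x ⟨y, hy, p, hp⟩
            cases p with
            | nil => simp at hp
            | cons hadj q =>
              exact ⟨_, subset_toMeasurable _ _ ⟨y, hy, q, by simpa using hp⟩, hadj⟩
        _ ≤ c * ν B := h _ (measurableSet_toMeasurable _ _)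
        _ ≤ c * (c ^ k * ν A) := by
            rw [measure_toMeasurable]
            exact mul_le_mul_right ih c
        _ = c ^ (k + 1) * ν A := by rw [pow_succ', mul_assoc]
  refine (measure_mono ?_).trans (hwalk k)
  rintro x ⟨y, hy, hxy⟩
  exact ⟨y, hy, (edist_eq_natCast_iff.1 hxy).1⟩

/-! ### Bounded Radon–Nikodym densities of partial injections -/

/-- A partial injection with graph `S` that distorts measure by at most the factor `K` has a
Radon–Nikodym derivative with values in `[K⁻¹, K]`. -/
theorem exists_bounded_density {V : Type*} [MeasurableSpace V] {ν : Measure V}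
    [IsFiniteMeasure ν] {S : Set (V × V)} {φ ψ : V → V} (hS : MeasurableSet S)
    (hφ : Measurable φ) (hψ : Measurable ψ) {K : ℝ} (hK : 1 ≤ K)
    (hup : ∀ A, MeasurableSet A → ν {y | (ψ y, y) ∈ S ∧ ψ y ∈ A} ≤
      ENNReal.ofReal K * ν {x | (x, φ x) ∈ S ∧ x ∈ A})
    (hdown : ∀ A, MeasurableSet A → ν {x | (x, φ x) ∈ S ∧ x ∈ A} ≤
      ENNReal.ofReal K * ν {y | (ψ y, y) ∈ S ∧ ψ y ∈ A}) :
    ∃ r : V → ℝ, Measurable r ∧ (∀ x, K⁻¹ ≤ r x ∧ r x ≤ K) ∧ ∀ A, MeasurableSet A →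
      ν {y | (ψ y, y) ∈ S ∧ ψ y ∈ A} =
        ∫⁻ x in {x | (x, φ x) ∈ S ∧ x ∈ A}, ENNReal.ofReal (r x) ∂ν := by
  have hK0 : 0 < K := one_pos.trans_le hK
  have hKi : K⁻¹ ≤ K := (inv_le_one_of_one_le₀ hK).trans hK
  have hC : MeasurableSet {x | (x, φ x) ∈ S} := (measurable_id.prodMk hφ) hS
  have hC' : MeasurableSet {y | (ψ y, y) ∈ S} := (hψ.prodMk measurable_id) hS
  let κ := ν.restrict {x | (x, φ x) ∈ S}
  -- The measure on the range is pulled back to the domain by pushing it forward along the inverse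
  -- `ψ`.
  let l := (ν.restrict {y | (ψ y, y) ∈ S}).map ψ
  have hκ : ∀ A, MeasurableSet A → κ A = ν {x | (x, φ x) ∈ S ∧ x ∈ A} := by
    intro A hA
    rw [Measure.restrict_apply hA, Set.inter_comm]
    rfl
  have hl : ∀ A, MeasurableSet A → l A = ν {y | (ψ y, y) ∈ S ∧ ψ y ∈ A} := by
    intro A hA
    rw [Measure.map_apply hψ hA, Measure.restrict_apply (hψ hA), Set.inter_comm]
    rfl
  have hac : l ≪ κ := by
    refine Measure.AbsolutelyContinuous.mk fun A hA h => ?_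
    rw [hκ A hA] at h
    rw [hl A hA, ← nonpos_iff_eq_zero]
    simpa [h] using hup A hA
  have hint : ∀ A, ∫⁻ x in A, l.rnDeriv κ x ∂κ = l A := Measure.setLIntegral_rnDeriv hac
  have hle : ∀ᵐ x ∂κ, l.rnDeriv κ x ≤ ENNReal.ofReal K := by
    refine ae_le_of_forall_setLIntegral_le_of_sigmaFinite (Measure.measurable_rnDeriv _ _)
      fun A hA _ => ?_
    rw [hint, setLIntegral_const, hl A hA, hκ A hA]
    exact hup A hA
  have hge : ∀ᵐ x ∂κ, ENNReal.ofReal K⁻¹ ≤ l.rnDeriv κ x := by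
    refine ae_le_of_forall_setLIntegral_le_of_sigmaFinite measurable_const fun A hA _ => ?_
    rw [hint, setLIntegral_const, hl A hA, hκ A hA, ENNReal.ofReal_inv_of_pos hK0,
      mul_comm, ← div_eq_mul_inv]
    refine ENNReal.div_le_of_le_mul ?_
    rw [mul_comm]
    exact hdown A hA
  -- Clamping gives the bounds everywhere and changes the derivative only on a `κ`-null set.
  refine ⟨fun x => max K⁻¹ (min K (l.rnDeriv κ x).toReal), ?_, ?_, ?_⟩
  · exact measurable_const.max
      (measurable_const.min (Measure.measurable_rnDeriv _ _).ennreal_toReal)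
  · exact fun x => ⟨le_max_left _ _, max_le hKi (min_le_left _ _)⟩
  · intro A hA
    have hset : {x | (x, φ x) ∈ S ∧ x ∈ A} = A ∩ {x | (x, φ x) ∈ S} := Set.inter_comm _ _
    rw [← hl A hA, ← hint, hset, ← Measure.restrict_restrict hA]
    refine lintegral_congr_ae (ae_restrict_of_ae ?_)
    filter_upwards [hle, hge] with x hx hx'
    have hne : l.rnDeriv κ x ≠ ∞ := ne_top_of_le_ne_top ENNReal.ofReal_ne_top hx
    have h1 : (l.rnDeriv κ x).toReal ≤ K := ENNReal.toReal_le_of_le_ofReal hK0.le hx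
    have h2 : K⁻¹ ≤ (l.rnDeriv κ x).toReal := (ENNReal.ofReal_le_iff_le_toReal hne).1 hx'
    rw [min_eq_right h1, max_eq_right h2, ENNReal.ofReal_toReal hne]

theorem isGraphInvariant_compl_graphSaturation {V : Type*} {G : SimpleGraph V}
    (B : Set V) :
    IsGraphInvariant G (graphSaturation G B)ᶜ := by
  ext y
  constructor
  · rintro ⟨x, hx, hxy⟩ ⟨z, hz, hzy⟩
    exact hx ⟨z, hz, hzy.trans hxy.symm⟩
  · exact fun hy => ⟨y, hy, SimpleGraph.Reachable.refl y⟩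

/-! ### From measure distortion to cocycle bounds -/

section Cocycle

variable {V : Type*} [MeasurableSpace V] {G : SimpleGraph V} {ν : Measure V}
  {S : ℕ → Set (V × V)} {φ ψ : ℕ → V → V} {k : ℕ → ℕ} {c : ℝ}

/-- If the graph metric distorts measure at most exponentially, then some version of the
Radon–Nikodym cocycle is bounded exponentially in the distance. -/
theorem exists_bounded_cocycle [IsFiniteMeasure ν] (hS : ∀ n, MeasurableSet (S n))
    (hφ : ∀ n, Measurable (φ n)) (hψ : ∀ n, Measurable (ψ n))
    (hdisj : Pairwise (Function.onFun Disjoint S)) (hcover : (⋃ n, S n) = connRel G)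
    (hmem : ∀ n x y, (x, y) ∈ S n → φ n x = y ∧ ψ n y = x ∧ G.edist x y = k n)
    (hc : 1 ≤ c)
    (hν : ∀ (j : ℕ) (A : Set V),
      ν {x | ∃ y ∈ A, G.edist x y = j} ≤ ENNReal.ofReal c ^ j * ν A) :
    ∃ ρ : V → V → ℝ, IsRadonNikodymCocycle G ν ρ ∧
      ∀ (x y : V) (j : ℕ), G.edist x y = j → (c ^ j)⁻¹ ≤ ρ x y ∧ ρ x y ≤ c ^ j := by
  have hc0 : 0 < c := one_pos.trans_le hc
  have hdens : ∀ n, ∃ r : V → ℝ, Measurable r ∧ (∀ x, (c ^ k n)⁻¹ ≤ r x ∧ r x ≤ c ^ k n) ∧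
      ∀ A, MeasurableSet A → ν {y | (ψ n y, y) ∈ S n ∧ ψ n y ∈ A} =
        ∫⁻ x in {x | (x, φ n x) ∈ S n ∧ x ∈ A}, ENNReal.ofReal (r x) ∂ν := by
    intro n
    refine exists_bounded_density (hS n) (hφ n) (hψ n) (one_le_pow₀ hc) ?_ ?_
    · intro A _
      rw [ENNReal.ofReal_pow hc0.le]
      refine (measure_mono ?_).trans (hν (k n) _)
      rintro y ⟨hy, hyA⟩
      obtain ⟨h1, -, h3⟩ := hmem n _ _ hy
      exact ⟨ψ n y, ⟨by rwa [h1], hyA⟩, by rwa [SimpleGraph.edist_comm]⟩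
    · intro A _
      rw [ENNReal.ofReal_pow hc0.le]
      refine (measure_mono ?_).trans (hν (k n) _)
      rintro x ⟨hx, hxA⟩
      obtain ⟨-, h2, h3⟩ := hmem n _ _ hx
      exact ⟨φ n x, ⟨by rwa [h2], by rwa [h2]⟩, h3⟩
  choose r hr hrb hri using hdens
  obtain ⟨ρ, hρ, hρS⟩ := exists_measurable_piecewise S hS (fun n p => r n p.1)
    (fun n => (hr n).comp measurable_fst) (fun i j hij p hp =>
      absurd hp.2 (Set.disjoint_left.1 (hdisj hij) hp.1))
  have hreach : ∀ x y, G.Reachable x y → ∃ n, (x, y) ∈ S n := by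
    intro x y h
    have : (x, y) ∈ ⋃ n, S n := hcover ▸ h
    simpa using this
  have hbound : ∀ (x y : V) (j : ℕ), G.edist x y = j →
      (c ^ j)⁻¹ ≤ ρ (x, y) ∧ ρ (x, y) ≤ c ^ j := by
    intro x y j hj
    obtain ⟨n, hn⟩ := hreach x y (SimpleGraph.edist_ne_top_iff_reachable.1 (by simp [hj]))
    have hjk : j = k n := by
      have := (hmem n x y hn).2.2
      rw [hj] at this
      exact_mod_cast this
    rw [hρS n hn, hjk]
    exact hrb n x
  refine ⟨fun x y => ρ (x, y), ⟨hρ.comp measurable_subtype_coe, ?_, ?_⟩, hbound⟩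
  · intro x y h
    obtain ⟨p, hp⟩ := h.exists_walk_length_eq_edist
    exact (inv_pos.2 (pow_pos hc0 _)).trans_le (hbound x y p.length hp.symm).1
  · intro C g hC hg hinj hCg
    -- On each of these pieces of `C`, `g` coincides with `φ n`, so the density of that piece
    -- computes the measure of the image.
    let T : ℕ → Set V := fun n => {x | x ∈ C ∧ (x, g x) ∈ S n}
    have hT : ∀ n, MeasurableSet (T n) := by
      intro n
      have : T n = Subtype.val '' ((fun x : C => ((x : V), C.domRestrict g x)) ⁻¹' S n) := by
        ext x
        simp [T, and_comm]
      rw [this]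
      exact hC.subtype_image ((measurable_subtype_coe.prodMk hg) (hS n))
    have hTC : ⋃ n, T n = C := by
      ext x
      simp only [Set.mem_iUnion]
      exact ⟨fun ⟨_, h⟩ => h.1, fun h => (hreach _ _ (hCg x h)).imp fun n hn => ⟨h, hn⟩⟩
    have hTd : Pairwise (Function.onFun Disjoint T) := fun i j hij =>
      Set.disjoint_left.2 fun x hi hj => Set.disjoint_left.1 (hdisj hij) hi.2 hj.2
    have himage : ∀ n, g '' T n = {y | (ψ n y, y) ∈ S n ∧ ψ n y ∈ T n} := by
      intro n
      ext y
      constructor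
      · rintro ⟨x, hx, rfl⟩
        have h2 := (hmem n _ _ hx.2).2.1
        exact ⟨by rw [h2]; exact hx.2, by rw [h2]; exact hx⟩
      · rintro ⟨hy, hyT⟩
        exact ⟨ψ n y, hyT, (hmem n _ _ hyT.2).1.symm.trans (hmem n _ _ hy).1⟩
    have hdomain : ∀ n, {x | (x, φ n x) ∈ S n ∧ x ∈ T n} = T n := by
      intro n
      ext x
      refine ⟨fun h => h.2, fun h => ⟨?_, h⟩⟩
      rw [(hmem n _ _ h.2).1]
      exact h.2
    have hpiece : ∀ n, ν (g '' T n) = ∫⁻ x in T n, ENNReal.ofReal (ρ (x, g x)) ∂ν := by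
      intro n
      rw [himage, hri n _ (hT n), hdomain]
      exact setLIntegral_congr_fun (hT n) fun x hx => by simp only [hρS n hx.2]
    have himeas : ∀ n, MeasurableSet (g '' T n) := by
      intro n
      rw [himage]
      exact (((hψ n).prodMk measurable_id) (hS n)).inter (hψ n (hT n))
    calc ν (g '' C) = ν (⋃ n, g '' T n) := by rw [← Set.image_iUnion, hTC]
      _ = ∑' n, ν (g '' T n) := measure_iUnion (fun i j hij =>
          Set.disjoint_image_image fun x hx y hy hxy =>
            Set.disjoint_left.1 (hTd hij) hx (hinj hx.1 hy.1 hxy ▸ hy)) himeas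
      _ = ∑' n, ∫⁻ x in T n, ENNReal.ofReal (ρ (x, g x)) ∂ν := tsum_congr hpiece
      _ = ∫⁻ x in C, ENNReal.ofReal (ρ (x, g x)) ∂ν := by
          rw [← lintegral_iUnion hT hTd, hTC]

theorem IsRadonNikodymCocycle.measurable_along {ρ : V → V → ℝ}
    (hρ : IsRadonNikodymCocycle G ν ρ) {C : Set V} {g : V → V} (hg : Measurable g)
    (hCg : ∀ x ∈ C, G.Reachable x (g x)) : Measurable fun x : C => ρ x (g x) :=
  hρ.measurable.comp (f := fun x : C => (⟨(x, g x), hCg x x.2⟩ : connRel G))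
    (Measurable.subtype_mk (measurable_subtype_coe.prodMk (hg.comp measurable_subtype_coe)))

theorem IsRadonNikodymCocycle.measurableSet_along {ρ : V → V → ℝ}
    (hρ : IsRadonNikodymCocycle G ν ρ) {C : Set V} {g : V → V} (hC : MeasurableSet C)
    (hg : Measurable g) (hCg : ∀ x ∈ C, G.Reachable x (g x)) {t : Set ℝ}
    (ht : MeasurableSet t) : MeasurableSet {x | x ∈ C ∧ ρ x (g x) ∈ t} := by
  have : {x | x ∈ C ∧ ρ x (g x) ∈ t} =
      Subtype.val '' ((fun x : C => ρ x (g x)) ⁻¹' t) := by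
    ext x
    simp [and_comm]
  rw [this]
  exact hC.subtype_image (hρ.measurable_along hg hCg ht)

/-- Integrating the strict bound over a set of positive finite measure would make the image too
large. -/
theorem IsRadonNikodymCocycle.measure_eq_zero_of_lt [IsFiniteMeasure ν] {ρ : V → V → ℝ}
    (hρ : IsRadonNikodymCocycle G ν ρ) {C : Set V} {g : V → V} (hC : MeasurableSet C)
    (hg : Measurable g) (hinj : Set.InjOn g C) (hCg : ∀ x ∈ C, G.Reachable x (g x)) {K : ℝ}
    (hK : 0 ≤ K) (hlt : ∀ x ∈ C, K < ρ x (g x))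
    (hle : ν (g '' C) ≤ ENNReal.ofReal K * ν C) : ν C = 0 := by
  by_contra h
  refine absurd hle (not_le.2 ?_)
  rw [hρ.measure_image C g hC (hg.comp measurable_subtype_coe) hinj hCg, ← setLIntegral_const]
  refine lintegral_strict_mono (by rwa [Ne, Measure.restrict_eq_zero]) ?_ ?_ ?_
  · exact aemeasurable_restrict_of_measurable_subtype hC
      (hρ.measurable_along hg hCg).ennreal_ofReal
  · rw [setLIntegral_const]
    exact ENNReal.mul_ne_top ENNReal.ofReal_ne_top (measure_ne_top _ _)
  · exact ae_restrict_of_forall_mem hC fun x hx =>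
      (ENNReal.ofReal_lt_ofReal_iff_of_nonneg hK).2 (hlt x hx)

theorem IsRadonNikodymCocycle.measure_eq_zero_of_gt [IsFiniteMeasure ν] {ρ : V → V → ℝ}
    (hρ : IsRadonNikodymCocycle G ν ρ) {C : Set V} {g : V → V} (hC : MeasurableSet C)
    (hg : Measurable g) (hinj : Set.InjOn g C) (hCg : ∀ x ∈ C, G.Reachable x (g x)) {K : ℝ}
    (hlt : ∀ x ∈ C, ρ x (g x) < K)
    (hle : ENNReal.ofReal K * ν C ≤ ν (g '' C)) : ν C = 0 := by
  by_contra h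
  refine absurd hle (not_le.2 ?_)
  rw [hρ.measure_image C g hC (hg.comp measurable_subtype_coe) hinj hCg, ← setLIntegral_const]
  refine lintegral_strict_mono (by rwa [Ne, Measure.restrict_eq_zero]) aemeasurable_const ?_ ?_
  · rw [← hρ.measure_image C g hC (hg.comp measurable_subtype_coe) hinj hCg]
    exact measure_ne_top _ _
  · exact ae_restrict_of_forall_mem hC fun x hx =>
      (ENNReal.ofReal_lt_ofReal_iff_of_nonneg (hρ.pos _ _ (hCg x hx)).le).2 (hlt x hx)

/-- If the graph metric distorts measure at most exponentially, then every version of the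
Radon–Nikodym cocycle is bounded exponentially in the distance on an invariant conull set. -/
theorem IsRadonNikodymCocycle.exists_invariant_bounded [IsFiniteMeasure ν]
    (hS : ∀ n, MeasurableSet (S n)) (hφ : ∀ n, Measurable (φ n))
    (hcover : (⋃ n, S n) = connRel G)
    (hmem : ∀ n x y, (x, y) ∈ S n → φ n x = y ∧ ψ n y = x ∧ G.edist x y = k n)
    (hc : 0 < c)
    (hν : ∀ (j : ℕ) (A : Set V),
      ν {x | ∃ y ∈ A, G.edist x y = j} ≤ ENNReal.ofReal c ^ j * ν A)
    (hqi : IsQuasiInvariant G ν) {ρ : V → V → ℝ} (hρ : IsRadonNikodymCocycle G ν ρ) :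
    ∃ A : Set V, MeasurableSet A ∧ IsGraphInvariant G A ∧ ν Aᶜ = 0 ∧
      ∀ x ∈ A, ∀ (y : V) (j : ℕ), G.edist x y = j → (c ^ j)⁻¹ ≤ ρ x y ∧ ρ x y ≤ c ^ j := by
  have hreach : ∀ x y, G.Reachable x y ↔ ∃ n, (x, y) ∈ S n := by
    intro x y
    change (x, y) ∈ connRel G ↔ _
    rw [← hcover, Set.mem_iUnion]
  let C : ℕ → Set V := fun n => {x | (x, φ n x) ∈ S n}
  have hC : ∀ n, MeasurableSet (C n) := fun n => (measurable_id.prodMk (hφ n)) (hS n)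
  have hCφ : ∀ n, ∀ x ∈ C n, G.Reachable x (φ n x) := fun n x hx => (hreach _ _).2 ⟨n, hx⟩
  have hinj : ∀ n, Set.InjOn (φ n) (C n) := by
    intro n x hx y hy hxy
    rw [← (hmem n _ _ hx).2.1, ← (hmem n _ _ hy).2.1, hxy]
  -- The countably many sets where the lower or the upper bound fails; each is null because `φ n`
  -- distorts ν by at most c ^ k n.
  let L : ℕ → Set V := fun n => {x | x ∈ C n ∧ ρ x (φ n x) ∈ Set.Iio (c ^ k n)⁻¹}
  let U : ℕ → Set V := fun n => {x | x ∈ C n ∧ ρ x (φ n x) ∈ Set.Ioi (c ^ k n)}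
  have hLm : ∀ n, MeasurableSet (L n) := fun n =>
    hρ.measurableSet_along (hC n) (hφ n) (hCφ n) measurableSet_Iio
  have hUm : ∀ n, MeasurableSet (U n) := fun n =>
    hρ.measurableSet_along (hC n) (hφ n) (hCφ n) measurableSet_Ioi
  have hL0 : ∀ n, ν (L n) = 0 := by
    intro n
    refine hρ.measure_eq_zero_of_gt (hLm n) (hφ n) ((hinj n).mono fun x hx => hx.1)
      (fun x hx => hCφ n x hx.1) (fun x hx => hx.2) ?_
    rw [ENNReal.ofReal_inv_of_pos (pow_pos hc _), mul_comm, ← div_eq_mul_inv]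
    refine ENNReal.div_le_of_le_mul ?_
    rw [mul_comm, ENNReal.ofReal_pow hc.le]
    refine (measure_mono ?_).trans (hν (k n) _)
    exact fun x hx => ⟨φ n x, ⟨x, hx, rfl⟩, (hmem n _ _ hx.1).2.2⟩
  have hU0 : ∀ n, ν (U n) = 0 := by
    intro n
    refine hρ.measure_eq_zero_of_lt (hUm n) (hφ n) ((hinj n).mono fun x hx => hx.1)
      (fun x hx => hCφ n x hx.1) (pow_pos hc _).le (fun x hx => hx.2) ?_
    rw [ENNReal.ofReal_pow hc.le]
    refine (measure_mono ?_).trans (hν (k n) _)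
    rintro _ ⟨x, hx, rfl⟩
    exact ⟨x, hx, by rw [SimpleGraph.edist_comm]; exact (hmem n _ _ hx.1).2.2⟩
  let B : Set V := ⋃ n, L n ∪ U n
  have hB : MeasurableSet B := MeasurableSet.iUnion fun n => (hLm n).union (hUm n)
  have hB0 : ν B = 0 := measure_iUnion_null fun n => measure_union_null (hL0 n) (hU0 n)
  -- Writing the saturation as a countable union of Borel preimages shows that it is Borel.
  have hsat : graphSaturation G B = ⋃ n, C n ∩ φ n ⁻¹' B := by
    ext y
    rw [Set.mem_iUnion]
    constructor
    · rintro ⟨x, hx, hxy⟩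
      obtain ⟨n, hn⟩ := (hreach y x).1 hxy.symm
      have h1 := (hmem n _ _ hn).1
      refine ⟨n, ?_, ?_⟩
      · change (y, φ n y) ∈ S n
        rwa [h1]
      · change φ n y ∈ B
        rwa [h1]
    · rintro ⟨n, hn, hB⟩
      exact ⟨φ n y, hB, (hCφ n y hn).symm⟩
  refine ⟨(graphSaturation G B)ᶜ, ?_, isGraphInvariant_compl_graphSaturation B, ?_, ?_⟩
  · rw [hsat]
    exact (MeasurableSet.iUnion fun n => (hC n).inter (hφ n hB)).compl
  · rw [compl_compl]
    exact hqi B hB hB0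
  · intro x hx y j hj
    obtain ⟨n, hn⟩ := (hreach x y).1 (SimpleGraph.edist_ne_top_iff_reachable.1 (by simp [hj]))
    obtain ⟨h1, -, h3⟩ := hmem n x y hn
    have hjk : j = k n := by
      rw [hj] at h3
      exact_mod_cast h3
    subst h1
    have hxB : x ∉ L n ∪ U n := fun h =>
      hx ⟨x, Set.mem_iUnion.2 ⟨n, h⟩, SimpleGraph.Reachable.refl x⟩
    rw [hjk]
    exact ⟨not_lt.1 fun h => hxB (Or.inl ⟨hn, h⟩), not_lt.1 fun h => hxB (Or.inr ⟨hn, h⟩)⟩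

end Cocycle

/-! ### The constant 4Δ and the main theorem -/

/-- A nontrivial walk forces Δ ≥ 1, hence 2Δ + 1 ≤ 4Δ; if Δ = 0 only j = 0 occurs and both sides are
1. -/
theorem pow_two_mul_add_one_le_of_edist_eq {V : Type*} {G : SimpleGraph V} {Δ : ℕ}
    (hΔ : DegreeBoundedBy G Δ) {x y : V} {j : ℕ} (h : G.edist x y = j) :
    (2 * (Δ : ℝ) + 1) ^ j ≤ (4 * (Δ : ℝ)) ^ j := by
  obtain ⟨⟨p, hp⟩, -⟩ := edist_eq_natCast_iff.1 h
  cases p with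
  | nil =>
    subst hp
    simp
  | cons hadj _ =>
    have h0 : Δ ≠ 0 := by
      rintro rfl
      have hx : G.neighborSet x = ∅ := by simpa using hΔ x
      exact Set.eq_empty_iff_forall_notMem.1 hx _ hadj
    have h1 : (1 : ℝ) ≤ Δ := by exact_mod_cast Nat.one_le_iff_ne_zero.2 h0
    exact pow_le_pow_left₀ (by positivity) (by linarith) j

theorem theorem1p2 {V : Type*} [MeasurableSpace V] [StandardBorelSpace V] (Δ : ℕ)
    (G : SimpleGraph V) (hG : IsBorelGraph G) (hΔ : DegreeBoundedBy G Δ)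
    (μ : Measure V) [IsProbabilityMeasure μ] (hμ : IsQuasiInvariant G μ) :
    ∃ ν : Measure V, IsProbabilityMeasure ν ∧ μ ≪ ν ∧ ν ≪ μ ∧
      -- some version of the cocycle satisfies the bounds everywhere
      (∃ ρ : V → V → ℝ, IsRadonNikodymCocycle G ν ρ ∧
        (∀ x y : V, G.Adj x y → 1 / (4 * (Δ : ℝ)) ≤ ρ x y ∧ ρ x y ≤ 4 * (Δ : ℝ)) ∧
        (∀ (x y : V) (k : ℕ), G.edist x y = (k : ℕ∞) → ρ x y ≤ (4 * (Δ : ℝ)) ^ k)) ∧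
      -- every version satisfies them on an invariant conull Borel set
      (∀ ρ : V → V → ℝ, IsRadonNikodymCocycle G ν ρ →
        ∃ A : Set V, MeasurableSet A ∧ IsGraphInvariant G A ∧ ν Aᶜ = 0 ∧
          (∀ x ∈ A, ∀ y ∈ A, G.Adj x y →
            1 / (4 * (Δ : ℝ)) ≤ ρ x y ∧ ρ x y ≤ 4 * (Δ : ℝ)) ∧
          (∀ x ∈ A, ∀ y ∈ A, ∀ k : ℕ, G.edist x y = (k : ℕ∞) →
            ρ x y ≤ (4 * (Δ : ℝ)) ^ k)) := by
  have : Nonempty V := nonempty_of_isProbabilityMeasure μ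
  obtain ⟨D, f, hD, hf, hDf⟩ := exists_partial_functions_of_encard_le Δ V
    {p : V × V | G.Adj p.1 p.2} hG hΔ
  obtain ⟨ν, hνp, hμν, hνμ, hν⟩ := exists_equivalent_measure_preimage_le hD hf μ (by
    intro i B hB h0
    refine measure_mono_null ?_ (hμ B hB h0)
    rintro x ⟨hx, hxB⟩
    exact ⟨f i x, hxB, ((hDf x (f i x)).2 ⟨i, hx, rfl⟩ : G.Adj _ _).symm.reachable⟩)
  obtain ⟨S, φ, ψ, k, hS, hφ, hψ, hdisj, hcover, hmem⟩ := exists_partition_connRel hD hf hDf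
  have hΔc : ENNReal.ofReal (2 * (Δ : ℝ) + 1) = 2 * Δ + 1 := by
    rw [ENNReal.ofReal_add (by positivity) one_pos.le, ENNReal.ofReal_mul zero_le_two]
    simp
  have hnbr : ∀ B, MeasurableSet B → ν {x | ∃ y ∈ B, G.Adj x y} ≤
      ENNReal.ofReal (2 * (Δ : ℝ) + 1) * ν B := by
    intro B hB
    rw [hΔc]
    refine (measure_mono ?_).trans (hν B hB)
    rintro x ⟨y, hy, hxy⟩
    obtain ⟨i, hi, rfl⟩ := (hDf x y).1 hxy
    exact Set.mem_iUnion.2 ⟨i, hi, hy⟩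
  have hdist := measure_edist_neighborhood_le hnbr
  have hc : (1 : ℝ) ≤ 2 * Δ + 1 := by
    have : (0 : ℝ) ≤ Δ := by positivity
    linarith
  have hqi : IsQuasiInvariant G ν := fun A hA h => hνμ (hμ A hA (hμν h))
  have hadj : ∀ {ρ : V → V → ℝ} {x y : V}, G.Adj x y →
      (∀ j : ℕ, G.edist x y = j → ((2 * (Δ : ℝ) + 1) ^ j)⁻¹ ≤ ρ x y ∧
        ρ x y ≤ (2 * (Δ : ℝ) + 1) ^ j) →
      1 / (4 * (Δ : ℝ)) ≤ ρ x y ∧ ρ x y ≤ 4 * (Δ : ℝ) := by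
    intro ρ x y hxy h
    have h1 : G.edist x y = (1 : ℕ) := by simpa using hxy
    have h2 := pow_two_mul_add_one_le_of_edist_eq hΔ h1
    have h3 := h 1 h1
    rw [pow_one] at h3
    rw [pow_one, pow_one] at h2
    refine ⟨le_trans ?_ h3.1, h3.2.trans h2⟩
    rw [one_div]
    exact inv_anti₀ (one_pos.trans_le hc) h2
  refine ⟨ν, hνp, hμν, hνμ, ?_, ?_⟩
  · obtain ⟨ρ, hρ, hb⟩ := exists_bounded_cocycle hS hφ hψ hdisj hcover hmem hc hdist
    exact ⟨ρ, hρ, fun x y h => hadj h (hb x y), fun x y j hj =>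
      (hb x y j hj).2.trans (pow_two_mul_add_one_le_of_edist_eq hΔ hj)⟩
  · intro ρ hρ
    obtain ⟨A, hA, hinv, hA0, hb⟩ := hρ.exists_invariant_bounded hS hφ hcover hmem
      (one_pos.trans_le hc) hdist hqi
    exact ⟨A, hA, hinv, hA0, fun x hx y _ h => hadj h (hb x hx y), fun x hx y _ j hj =>
      (hb x hx y j hj).2.trans (pow_two_mul_add_one_le_of_edist_eq hΔ hj)⟩
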